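/- **Model.** Let $0<W_d<W_e$, $\alpha,\beta,\epsilon>0$, $0\le\delta\le1$, $p\ge0$, $0\le r\le1$. Two firms own $N_1=\delta$ and $N_2=1-\delta$ parking spots. In stage one each firm $i$ chooses, simultaneously with the other firm $j$, the number $N_{ei}$ of its spots to equip for electric vehicles (EV), at cost $p$ per spot; the remaining $N_{di}=N_i-N_{ei}$ spots serve combustion-engine (ICE) drivers. In stage two, having observed $(N_{e1},N_{e2})$, the firms simultaneously choose prices $c_i\in\mathbb R$ for EV drivers and $m_i\in\mathbb R$ for ICE drivers. The quantities served are the solution of the Wardrop conditions "zero marginal utility at both firms", $$W_e(1-\alpha(q_{e1}+q_{e2}))-\epsilon\frac{q_{ei}}{N_{ei}}-c_i=0,\qquad W_d(1-\beta(q_{d1}+q_{d2}))-\epsilon\frac{q_{di}}{N_{di}}-m_i=0\qquad(i=1,2),$$ where a firm without spots for a class serves quantity $0$ of that class (in place of its equation); that is, $$q_{ei}=\frac{N_{ei}\bigl(W_e(1+\alpha\tfrac{N_{ej}}{\epsilon}(c_j-c_i))-c_i\bigr)}{\alpha W_e(N_{ei}+N_{ej})+\epsilon},\qquad q_{di}=\frac{N_{di}\bigl(W_d(1+\beta\tfrac{N_{dj}}{\epsilon}(m_j-m_i))-m_i\bigr)}{\beta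 W_d(N_{di}+N_{dj})+\epsilon}.$$ These expressions are used for all real prices. Firm $i$'s payoff is $\Pi_i=m_iq_{di}+c_iq_{ei}-pN_{ei}$. *Pricing schemes.* Two price: no constraint on $(c_i,m_i)$. Optimal single price: $c_i=m_i$. "Naive" single price: $c_i=m_i$, where $m_i$ is firm $i$'s price in a Nash equilibrium of the pricing game without chargers, in which firm $i$ maximizes $m_iq_{di}$ with $N_{d1}=\delta$, $N_{d2}=1-\delta$. *Capacity rules.* "Naive" mandate fulfillment: $N_{ei}=rN_i$. Optimal capacity: $rN_i\le N_{ei}\le N_i$. A strategy of firm $i$ consists of a feasible $N_{ei}$ and an admissible price pair for every feasible pair $(N_{e1},N_{e2})$. A subgame-perfect Nash equilibrium (SPNE) is a strategy profile that induces a Nash equilibrium in the pricing subgame after every feasible $(N_{e1},N_{e2})$ and is a Nash equilibrium of the whole game. **Proposition.** 1. Under "naive" mandate fulfillment, for each of the three pricing schemes an SPNE exists and is unique. Here uniqueness means that any two SPNE have the same capacities and the same price $c_i$ whenever $N_{ei}>0$ and the same price $m_i$ whenever $N_{di}>0$ (the price of nonexistent spots is payoff-irrelevant). In particular, if $0<\delta<1$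 and, for the two-price scheme, also $0<r<1$, there is exactly one SPNE. 2. Under optimal capacity and the two-price scheme, an SPNE exists if $\alpha W_e\le1$, $\beta W_d\le1$ and $\epsilon=1$. 3. Under optimal capacity and the "naive" single-price scheme, an SPNE exists for all parameter values as above. -/

import Mathlib

namespace EVParking

/-- Parameters of the duopoly: intercepts `We > Wd > 0` and slopes `α, β > 0` of the inverse demands
of EV and ICE drivers, congestion constant `ε > 0`, share `δ` of the unit mass of spots owned by the
first firm, cost `p` of equipping one spot with a charger, mandated proportion `r` of EV spots. -/
structure Market where
  We : ℝ
  Wd : ℝ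
  α : ℝ
  β : ℝ
  ε : ℝ
  δ : ℝ
  p : ℝ
  r : ℝ
  Wd_pos : 0 < Wd
  Wd_lt_We : Wd < We
  α_pos : 0 < α
  β_pos : 0 < β
  ε_pos : 0 < ε
  δ_nonneg : 0 ≤ δ
  δ_le_one : δ ≤ 1
  p_nonneg : 0 ≤ p
  r_nonneg : 0 ≤ r
  r_le_one : r ≤ 1

/-- The opponent of firm `i`. -/
def other (i : Fin 2) : Fin 2 := 1 - i

/-- Utility of the marginal driver of a class parked at firm `i`: inverse demand `W (1 - a Q)`, minus
the congestion cost `ε qᵢ / Nᵢ`, minus the price. -/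
noncomputable def marginalUtility (W a ε : ℝ) (N price q : Fin 2 → ℝ) (i : Fin 2) : ℝ :=
  W * (1 - a * (q 0 + q 1)) - ε * (q i / N i) - price i

/-- The Wardrop conditions on which the quantities of the game are based: marginal utilities vanish
at both firms; a firm without spots for the class serves nobody. -/
def IsWardrop (W a ε : ℝ) (N price q : Fin 2 → ℝ) : Prop :=
  ∀ i, (N i = 0 → q i = 0) ∧ (N i ≠ 0 → marginalUtility W a ε N price q i = 0)

/-- Quantity of a class of drivers served by firm `i`: the closed-form solution of the Wardrop
conditions, with the denominators `Nᵢ` cleared so that the value is `0` when `Nᵢ = 0`. -/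
noncomputable def quantity (W a ε : ℝ) (N price : Fin 2 → ℝ) (i : Fin 2) : ℝ :=
  N i * (W * (1 + a * (N (other i) / ε) * (price (other i) - price i)) - price i) /
    (a * W * (N i + N (other i)) + ε)

theorem isWardrop_iff {W a ε : ℝ} (hW : 0 < W) (ha : 0 < a) (hε : 0 < ε) {N : Fin 2 → ℝ}
    (hN : ∀ i, 0 ≤ N i) (price q : Fin 2 → ℝ) :
    IsWardrop W a ε N price q ↔ q = quantity W a ε N price := by
  have hx := hN 0
  have hy := hN 1
  have haW : 0 < a * W := mul_pos ha hW
  have hD : 0 < a * W * (N 0 + N 1) + ε := by positivity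
  have hD' : 0 < a * W * (N 1 + N 0) + ε := by positivity
  -- both sides are equivalent to the system `ε qᵢ = Nᵢ (W (1 - a (q₀ + q₁)) - priceᵢ)`
  have key : IsWardrop W a ε N price q ↔
      (ε * q 0 = N 0 * (W * (1 - a * (q 0 + q 1)) - price 0) ∧
        ε * q 1 = N 1 * (W * (1 - a * (q 0 + q 1)) - price 1)) := by
    have one : ∀ i, ((N i = 0 → q i = 0) ∧ (N i ≠ 0 → marginalUtility W a ε N price q i = 0)) ↔
        ε * q i = N i * (W * (1 - a * (q 0 + q 1)) - price i) := by
      intro i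
      by_cases h : N i = 0
      · simp [h, hε.ne']
      · simp only [h, false_imp_iff, true_and, ne_eq, not_false_eq_true, true_imp_iff,
          marginalUtility]
        constructor
        · intro h1
          field_simp at h1
          linarith
        · intro h1
          field_simp
          linarith
    simp [IsWardrop, Fin.forall_fin_two, one]
  rw [key]
  constructor
  · rintro ⟨h0, h1⟩
    funext i
    fin_cases i
    · simp only [quantity, other, Fin.zero_eta, sub_zero]
      rw [eq_div_iff hD.ne']
      field_simp
      linear_combination (ε + a * W * N 1) * h0 - a * W * N 0 * h1
    · simp only [quantity, other, Fin.mk_one, sub_self]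
      rw [eq_div_iff hD'.ne']
      field_simp
      linear_combination (ε + a * W * N 0) * h1 - a * W * N 1 * h0
  · rintro rfl
    simp only [quantity, other, sub_zero, sub_self]
    rw [add_comm (N 1) (N 0)]
    constructor <;> · field_simp; ring

/-- The prices of one firm: `ev` for EV drivers and `ice` for ICE drivers. -/
@[ext]
structure Tariff where
  ev : ℝ
  ice : ℝ

inductive PricingScheme
  | twoPrice
  | optimalSingle
  | naiveSingle

inductive CapacityRule
  | naiveMandate
  | optimalCapacity

namespace Market

variable (M : Market)

/-- Total number of spots of each firm. -/
def spots : Fin 2 → ℝ := ![M.δ, 1 - M.δ]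

/-- Profit of firm `i` when the firms have equipped `n 0` and `n 1` spots with chargers. -/
noncomputable def profit (n : Fin 2 → ℝ) (t : Fin 2 → Tariff) (i : Fin 2) : ℝ :=
  (t i).ice * quantity M.Wd M.β M.ε (fun j => M.spots j - n j) (fun j => (t j).ice) i +
    (t i).ev * quantity M.We M.α M.ε n (fun j => (t j).ev) i - M.p * n i

/-- Revenue in the market without chargers, in which all spots serve ICE drivers. -/
noncomputable def preEVRevenue (m : Fin 2 → ℝ) (i : Fin 2) : ℝ :=
  m i * quantity M.Wd M.β M.ε M.spots m i

/-- Nash equilibria of the pricing game without chargers. -/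
def IsPreEVEquilibrium (m : Fin 2 → ℝ) : Prop :=
  ∀ i x, M.preEVRevenue (Function.update m i x) i ≤ M.preEVRevenue m i

/-- The constraint that a pricing scheme puts on the prices of firm `i`: none; a common price; a
common price kept from an equilibrium of the market without chargers. -/
def admissibleTariffs : PricingScheme → Fin 2 → Set Tariff
  | .twoPrice, _ => Set.univ
  | .optimalSingle, _ => {t | t.ev = t.ice}
  | .naiveSingle, i => {t | t.ev = t.ice ∧ ∃ m, M.IsPreEVEquilibrium m ∧ m i = t.ice}

/-- The numbers of EV spots that firm `i` may choose: exactly the mandate, or at least the mandate. -/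
def capacitySet : CapacityRule → Fin 2 → Set ℝ
  | .naiveMandate, i => {M.r * M.spots i}
  | .optimalCapacity, i => {x | 0 ≤ x ∧ 0 ≤ M.spots i - x ∧ M.r * M.spots i ≤ x}

/-- Possible outcomes of the first stage. -/
abbrev Capacities (k : CapacityRule) : Type := ∀ i, M.capacitySet k i

/-- A strategy of firm `i`: a number of EV spots, and prices after every first-stage outcome. -/
@[ext]
structure Strategy (k : CapacityRule) (c : PricingScheme) (i : Fin 2) where
  capacity : M.capacitySet k i
  tariff : M.Capacities k → M.admissibleTariffs c i

abbrev Profile (k : CapacityRule) (c : PricingScheme) : Type := ∀ i, M.Strategy k c i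

variable {M} {k : CapacityRule} {c : PricingScheme}

/-- First-stage outcome of a strategy profile. -/
def Profile.capacities (s : M.Profile k c) : M.Capacities k := fun i => (s i).capacity

/-- Profit of firm `i` in the subgame after the first-stage outcome `n`. -/
noncomputable def subgameProfit (n : M.Capacities k) (t : ∀ i, M.admissibleTariffs c i)
    (i : Fin 2) : ℝ :=
  M.profit (fun j => (n j : ℝ)) (fun j => (t j : Tariff)) i

/-- Profit of firm `i` in the whole game. -/
noncomputable def Profile.payoff (s : M.Profile k c) (i : Fin 2) : ℝ :=
  subgameProfit s.capacities (fun j => (s j).tariff s.capacities) i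

/-- Subgame-perfect Nash equilibrium: a Nash equilibrium in the subgame after every first-stage
outcome and in the whole game. -/
def Profile.IsSPNE (s : M.Profile k c) : Prop :=
  (∀ (n : M.Capacities k) (i : Fin 2) (t : M.admissibleTariffs c i),
    subgameProfit n (Function.update (fun j => (s j).tariff n) i t) i ≤
      subgameProfit n (fun j => (s j).tariff n) i) ∧
  ∀ (i : Fin 2) (s' : M.Strategy k c i),
    Profile.payoff (Function.update s i s') i ≤ Profile.payoff s i

/-- Two profiles agree up to prices of nonexistent spots: same numbers of EV spots, and after every
first-stage outcome the same prices for all classes of drivers for which the firm has spots. -/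
def Profile.AgreeOnSpots (s s' : M.Profile k c) : Prop :=
  ∀ i, (s i).capacity = (s' i).capacity ∧ ∀ n : M.Capacities k,
    (0 < (n i : ℝ) → ((s i).tariff n : Tariff).ev = ((s' i).tariff n : Tariff).ev) ∧
    (0 < M.spots i - n i → ((s i).tariff n : Tariff).ice = ((s' i).tariff n : Tariff).ice)

end Market

end EVParking

/-! For fixed capacities the quantity of a class is affine in both prices, so revenue is a concave
quadratic in the own price and a pricing equilibrium is a solution of the linear system `2 Sᵢ zᵢ =
Pᵢ + Q zⱼ`. The cross slope `Q` is common to both firms and bounded by each own slope, so the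
determinant `4 S₀ S₁ - Q²` is positive unless an own slope vanishes, in which case `Q = 0` and the
equations decouple. Hence prices exist and are determined wherever the own slope is positive
(`exists_firstOrder`, `firstOrder_unique`). With two prices the game splits into one such game per
class; with an optimal single price the two demands add up to one of the same form; with naive
prices, uniqueness in the market without chargers leaves a firm with spots a single tariff. The
naive mandate leaves no choice of capacity, so this settles the first claim.

If capacities are chosen, it suffices to find an equilibrium of the reduced game in which prices are
those of the subgame equilibria (`exists_isSPNE`). Unique best replies are continuous by
compactness, and their composite is a continuous self-map of an interval, which has a fixed point
(`exists_nash_of_unique_replies`). Uniqueness of replies comes from strict concavity or strict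
monotonicity in the own capacity. For two prices, equilibrium revenue is a rational function whose
partial fractions are all concave when the opponent's scaled capacity is at most 1
(`strictConcaveOn_scaledRevenue`); the bounds on `α We` and `β Wd` serve this purpose. For naive
prices, ICE revenue is strictly concave and strictly decreasing in the number of EV spots, while EV
revenue is strictly concave or nonincreasing according to the sign of one factor. -/

namespace EVParking

open Set

/-! ### Concave quadratics and linear first-order conditions -/

/-- A quadratic `z (B - S z)` with `S ≥ 0` is maximal exactly where its derivative vanishes. -/
theorem forall_mul_sub_le_iff {S B c : ℝ} (hS : 0 ≤ S) (hB : S = 0 → B = 0) :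
    (∀ z, z * (B - S * z) ≤ c * (B - S * c)) ↔ 2 * S * c = B := by
  constructor
  · intro h
    rcases hS.eq_or_lt with h0 | h0
    · rw [hB h0.symm, ← h0]; ring
    -- Comparison with the vertex, where the value is `B² / (4S)`, forces `(2Sc - B)² ≤ 0`.
    · have h1 := h (B / (2 * S))
      have h2 : B / (2 * S) * (B - S * (B / (2 * S))) = B ^ 2 / (4 * S) := by
        field_simp; ring
      rw [h2, div_le_iff₀ (by positivity)] at h1
      have h3 : (2 * S * c - B) ^ 2 = 0 := le_antisymm (by nlinarith) (sq_nonneg _)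
      have := pow_eq_zero_iff (two_ne_zero) |>.1 h3
      linarith
  · rintro rfl z
    nlinarith [mul_nonneg hS (sq_nonneg (z - c))]

@[simp]
theorem other_zero : other 0 = 1 := rfl

@[simp]
theorem other_one : other 1 = 0 := rfl

@[simp]
theorem other_other (i : Fin 2) : other (other i) = i := by
  fin_cases i <;> rfl

theorem other_ne (i : Fin 2) : other i ≠ i := by
  fin_cases i <;> decide

/-- The first-order conditions of two firms with symmetric cross slope `Q` have a solution. -/
theorem exists_firstOrder {P S : Fin 2 → ℝ} {Q : ℝ} (hQ : 0 ≤ Q) (hQS : ∀ i, Q ≤ S i)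
    (hP : ∀ i, S i = 0 → P i = 0) :
    ∃ z : Fin 2 → ℝ, ∀ i, 2 * S i * z i = P i + Q * z (other i) := by
  by_cases hQ0 : Q = 0
  · refine ⟨fun i => P i / (2 * S i), fun i => ?_⟩
    -- The equations decouple; for `S i = 0` the witness is `0` by the convention on division, which
    -- is a solution since `P i = 0`.
    by_cases hi : S i = 0
    · simp [hi, hP i hi, hQ0]
    · simp only [hQ0]; field_simp; simp
  · have hQ' : 0 < Q := lt_of_le_of_ne hQ (Ne.symm hQ0)
    have h0 := hQS 0
    have h1 := hQS 1
    -- Both slopes are at least `Q > 0`, so the determinant is at least `3 Q²`, and the witness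
    -- below is Cramer's rule.
    have hdet : 0 < 4 * S 0 * S 1 - Q ^ 2 := by nlinarith
    refine ⟨fun i => (2 * S (other i) * P i + Q * P (other i)) / (4 * S 0 * S 1 - Q ^ 2), ?_⟩
    rw [Fin.forall_fin_two]
    simp only [other_zero, other_one]
    have hD := hdet.ne'
    generalize hd : 4 * S 0 * S 1 - Q ^ 2 = D at hD
    constructor
    · field_simp
      linear_combination P 0 * hd
    · field_simp
      linear_combination P 1 * hd

/-- The first-order conditions determine the price of every firm with a positive own slope. -/
theorem firstOrder_unique {P S z z' : Fin 2 → ℝ} {Q : ℝ} (hQ : 0 ≤ Q) (hQS : ∀ i, Q ≤ S i)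
    (hz : ∀ i, 2 * S i * z i = P i + Q * z (other i))
    (hz' : ∀ i, 2 * S i * z' i = P i + Q * z' (other i)) {i : Fin 2} (hi : 0 < S i) :
    z i = z' i := by
  have e1 := hz i
  have e2 := hz (other i)
  have e1' := hz' i
  have e2' := hz' (other i)
  rw [other_other] at e2 e2'
  have hj := hQS (other i)
  have hi' := hQS i
  rcases (hQ.trans hj).eq_or_lt with h0 | h0
  · have hQ0 : Q = 0 := by linarith
    rw [hQ0] at e1 e1'
    have h : 2 * S i * (z i - z' i) = 0 := by linarith
    have := (mul_eq_zero.1 h).resolve_left (by positivity)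
    linarith
  · have hdet : 0 < 4 * S i * S (other i) - Q ^ 2 := by nlinarith [mul_pos hi h0]
    have h : (4 * S i * S (other i) - Q ^ 2) * (z i - z' i) = 0 := by
      linear_combination 2 * S (other i) * (e1 - e1') + Q * (e2 - e2')
    have := (mul_eq_zero.1 h).resolve_left hdet.ne'
    linarith

/-! ### Demand and price equilibrium of a single class -/

/-- Quantity served by a firm with `x` spots and price `c` against a firm with `y` spots and
price `c'`. -/
noncomputable def served (W a ε x y c c' : ℝ) : ℝ :=
  x * (W * (1 + a * (y / ε) * (c' - c)) - c) / (a * W * (x + y) + ε)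

/-- Quantity served at zero prices. -/
noncomputable def servedAtZero (W a ε x y : ℝ) : ℝ := x * W / (a * W * (x + y) + ε)

/-- Sensitivity of the quantity served to the price of the opponent. -/
noncomputable def crossSlope (W a ε x y : ℝ) : ℝ := x * (a * W / ε * y) / (a * W * (x + y) + ε)

/-- Sensitivity of the quantity served to the own price. -/
noncomputable def ownSlope (W a ε x y : ℝ) : ℝ :=
  x / (a * W * (x + y) + ε) + crossSlope W a ε x y

theorem quantity_eq_served (W a ε : ℝ) (N price : Fin 2 → ℝ) (i : Fin 2) :
    quantity W a ε N price i = served W a ε (N i) (N (other i)) (price i) (price (other i)) :=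
  rfl

theorem served_zero (W a ε y c c' : ℝ) : served W a ε 0 y c c' = 0 := by simp [served]

theorem crossSlope_comm (W a ε x y : ℝ) : crossSlope W a ε x y = crossSlope W a ε y x := by
  unfold crossSlope; rw [add_comm x y]; ring

theorem served_eq (W a ε x y c c' : ℝ) :
    served W a ε x y c c' =
      servedAtZero W a ε x y + crossSlope W a ε x y * c' - ownSlope W a ε x y * c := by
  unfold served servedAtZero ownSlope crossSlope; ring

section
variable {W a ε x y : ℝ} (hW : 0 < W) (ha : 0 < a) (hε : 0 < ε) (hx : 0 ≤ x) (hy : 0 ≤ y)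
include hW ha hε hx hy

theorem crossSlope_nonneg : 0 ≤ crossSlope W a ε x y := by unfold crossSlope; positivity

theorem crossSlope_le_ownSlope : crossSlope W a ε x y ≤ ownSlope W a ε x y := by
  have : 0 ≤ x / (a * W * (x + y) + ε) := by positivity
  unfold ownSlope; linarith

theorem ownSlope_nonneg : 0 ≤ ownSlope W a ε x y :=
  (crossSlope_nonneg hW ha hε hx hy).trans (crossSlope_le_ownSlope hW ha hε hx hy)

theorem ownSlope_pos (hx' : 0 < x) : 0 < ownSlope W a ε x y := by
  have : 0 < x / (a * W * (x + y) + ε) := by positivity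
  have := crossSlope_nonneg hW ha hε hx hy
  unfold ownSlope; linarith

end

/-- Equilibrium price of a firm with `x` spots against a firm with `y` spots. -/
noncomputable def eqPrice (W a ε x y : ℝ) : ℝ :=
  W * (2 + 2 * (a * W / ε * x) + a * W / ε * y) /
    (4 + 4 * (a * W / ε * x) + 4 * (a * W / ε * y) + 3 * (a * W / ε * x) * (a * W / ε * y))

section
variable {W a ε x y : ℝ} (hW : 0 < W) (ha : 0 < a) (hε : 0 < ε) (hx : 0 ≤ x) (hy : 0 ≤ y)
include hW ha hε hx hy

theorem eqPrice_pos : 0 < eqPrice W a ε x y := by unfold eqPrice; positivity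

theorem eqPrice_lt : eqPrice W a ε x y < W := by
  have h : 0 < a * W / ε := by positivity
  unfold eqPrice
  generalize a * W / ε = A at h
  have hu : 0 ≤ A * x := by positivity
  have hv : 0 ≤ A * y := by positivity
  rw [div_lt_iff₀ (by positivity)]
  have := mul_nonneg hu hv
  nlinarith

/-- With `u = aWx/ε` and `v = aWy/ε`, cancelling the common factor `x / (aW(x+y) + ε)` from the
first-order conditions leaves `2(1+v)c = W + vc'` and `2(1+u)c' = W + uc`, of determinant
`4(1+u)(1+v) - uv`. `eqPrice` is the solution by Cramer's rule and makes sense also without spots.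
-/
theorem eqPrice_reply :
    2 * (1 + a * W / ε * y) * eqPrice W a ε x y = W + a * W / ε * y * eqPrice W a ε y x := by
  have h : 0 < a * W / ε := by positivity
  unfold eqPrice
  generalize a * W / ε = A at h
  have hu : 0 ≤ A * x := by positivity
  have hv : 0 ≤ A * y := by positivity
  generalize A * x = u at hu
  generalize A * y = v at hv
  have h1 : 0 < 4 + 4 * u + 4 * v + 3 * u * v := by positivity
  have h2 : 4 + 4 * v + 4 * u + 3 * v * u = 4 + 4 * u + 4 * v + 3 * u * v := by ring
  rw [h2]
  field_simp
  ring

theorem eqPrice_firstOrder :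
    2 * ownSlope W a ε x y * eqPrice W a ε x y =
      servedAtZero W a ε x y + crossSlope W a ε x y * eqPrice W a ε y x := by
  have h := eqPrice_reply hW ha hε hx hy
  have e : 2 * ownSlope W a ε x y * eqPrice W a ε x y =
      x / (a * W * (x + y) + ε) * (2 * (1 + a * W / ε * y) * eqPrice W a ε x y) := by
    unfold ownSlope crossSlope; ring
  rw [e, h]
  unfold crossSlope servedAtZero; ring

/-- The equilibrium price maximizes revenue against the equilibrium price of the opponent. -/
theorem revenue_le_eqPrice (z : ℝ) :
    z * served W a ε x y z (eqPrice W a ε y x) ≤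
      eqPrice W a ε x y * served W a ε x y (eqPrice W a ε x y) (eqPrice W a ε y x) := by
  rw [served_eq, served_eq]
  refine (forall_mul_sub_le_iff (ownSlope_nonneg hW ha hε hx hy) (fun h => ?_)).2
    (eqPrice_firstOrder hW ha hε hx hy) z
  rcases hx.eq_or_lt with rfl | hx'
  · simp [servedAtZero, crossSlope]
  · exact absurd h (ownSlope_pos hW ha hε hx hy hx').ne'

/-- First-order condition of a price that maximizes revenue. -/
theorem firstOrder_of_forall_revenue_le {c c' : ℝ}
    (h : ∀ z, z * served W a ε x y z c' ≤ c * served W a ε x y c c') :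
    2 * ownSlope W a ε x y * c = servedAtZero W a ε x y + crossSlope W a ε x y * c' := by
  simp only [served_eq] at h
  refine (forall_mul_sub_le_iff (ownSlope_nonneg hW ha hε hx hy) (fun h => ?_)).1 h
  rcases hx.eq_or_lt with rfl | hx'
  · simp [servedAtZero, crossSlope]
  · exact absurd h (ownSlope_pos hW ha hε hx hy hx').ne'

end

/-- Two revenue equilibria agree in the price of every firm with spots. -/
theorem revenue_equilibrium_unique {W a ε : ℝ} (hW : 0 < W) (ha : 0 < a) (hε : 0 < ε)
    {N c c' : Fin 2 → ℝ} (hN : ∀ i, 0 ≤ N i)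
    (h : ∀ i z, z * served W a ε (N i) (N (other i)) z (c (other i)) ≤
      c i * served W a ε (N i) (N (other i)) (c i) (c (other i)))
    (h' : ∀ i z, z * served W a ε (N i) (N (other i)) z (c' (other i)) ≤
      c' i * served W a ε (N i) (N (other i)) (c' i) (c' (other i)))
    {i : Fin 2} (hi : 0 < N i) : c i = c' i := by
  have hcross : ∀ i, crossSlope W a ε (N i) (N (other i)) = crossSlope W a ε (N 0) (N 1) := by
    rw [Fin.forall_fin_two]; exact ⟨rfl, crossSlope_comm ..⟩
  refine firstOrder_unique (P := fun i => servedAtZero W a ε (N i) (N (other i)))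
    (S := fun i => ownSlope W a ε (N i) (N (other i))) (Q := crossSlope W a ε (N 0) (N 1))
    (crossSlope_nonneg hW ha hε (hN 0) (hN 1)) (fun j => ?_) (fun j => ?_) (fun j => ?_)
    (ownSlope_pos hW ha hε (hN i) (hN _) hi)
  · rw [← hcross j]; exact crossSlope_le_ownSlope hW ha hε (hN _) (hN _)
  · rw [← hcross j]; exact firstOrder_of_forall_revenue_le hW ha hε (hN _) (hN _) (h j)
  · rw [← hcross j]; exact firstOrder_of_forall_revenue_le hW ha hε (hN _) (hN _) (h' j)

/-! ### Nash equilibria from unique best replies -/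

/-- If a continuous function on a compact space has at most one maximizer for every value of a
parameter, then the maximizer depends continuously on the parameter. -/
theorem exists_continuous_argmax {X Y : Type*} [TopologicalSpace X] [CompactSpace X] [Nonempty X]
    [TopologicalSpace Y] {F : X × Y → ℝ} (hF : Continuous F)
    (huniq : ∀ y x x', (∀ z, F (z, y) ≤ F (x, y)) → (∀ z, F (z, y) ≤ F (x', y)) → x = x') :
    ∃ g : Y → X, Continuous g ∧ ∀ y x, F (x, y) ≤ F (g y, y) := by
  have hex : ∀ y, ∃ x, ∀ z, F (z, y) ≤ F (x, y) := fun y => by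
    obtain ⟨x, -, hx⟩ := isCompact_univ.exists_isMaxOn univ_nonempty
      (f := fun x => F (x, y)) (hF.comp (by fun_prop)).continuousOn
    exact ⟨x, fun z => hx (mem_univ z)⟩
  choose g hg using hex
  refine ⟨g, continuous_iff_isClosed.2 fun C hC => ?_, hg⟩
  -- The preimage of `C` under `g` is the projection, along the compact factor, of a closed set of
  -- maximizing pairs, hence closed.
  have hgraph : IsClosed {w : X × Y | w.1 ∈ C ∧ ∀ z, F (z, w.2) ≤ F w} := by
    refine (hC.preimage continuous_fst).inter ?_
    have : {w : X × Y | ∀ z, F (z, w.2) ≤ F w} = ⋂ z, {w : X × Y | F (z, w.2) ≤ F w} := by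
      ext; simp
    change IsClosed {w : X × Y | ∀ z, F (z, w.2) ≤ F w}
    rw [this]
    exact isClosed_iInter fun z => isClosed_le (hF.comp (by fun_prop)) hF
  have himage : g ⁻¹' C = Prod.snd '' {w : X × Y | w.1 ∈ C ∧ ∀ z, F (z, w.2) ≤ F w} := by
    ext y
    constructor
    · intro hy
      exact ⟨(g y, y), ⟨hy, hg y⟩, rfl⟩
    · rintro ⟨⟨x, y'⟩, ⟨hx, hmax⟩, rfl⟩
      have : g y' = x := huniq y' _ _ (hg y') hmax
      simpa only [mem_preimage, this] using hx
  rw [himage]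
  exact isClosedMap_snd_of_compactSpace _ hgraph

/-- A two-player game on compact intervals with continuous payoffs and unique best replies has a
Nash equilibrium. In `F i x y`, the choice of player `i` is `x` and that of the opponent is `y`. -/
theorem exists_nash_of_unique_replies {l u : Fin 2 → ℝ} (hlu : ∀ i, l i ≤ u i)
    {F : Fin 2 → ℝ → ℝ → ℝ}
    (hF : ∀ i, ContinuousOn (fun w : ℝ × ℝ => F i w.1 w.2)
      (Icc (l i) (u i) ×ˢ Icc (l (other i)) (u (other i))))
    (huniq : ∀ i, ∀ y ∈ Icc (l (other i)) (u (other i)), ∀ x ∈ Icc (l i) (u i),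
      ∀ x' ∈ Icc (l i) (u i), IsMaxOn (fun z => F i z y) (Icc (l i) (u i)) x →
      IsMaxOn (fun z => F i z y) (Icc (l i) (u i)) x' → x = x') :
    ∃ n : Fin 2 → ℝ, (∀ i, n i ∈ Icc (l i) (u i)) ∧
      ∀ i, ∀ x ∈ Icc (l i) (u i), F i x (n (other i)) ≤ F i (n i) (n (other i)) := by
  have hreply : ∀ i, ∃ g : Icc (l (other i)) (u (other i)) → Icc (l i) (u i), Continuous g ∧
      ∀ (y : Icc (l (other i)) (u (other i))) (x : Icc (l i) (u i)), F i x y ≤ F i (g y) y := by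
    intro i
    have : Nonempty (Icc (l i) (u i)) := ⟨⟨l i, left_mem_Icc.2 (hlu i)⟩⟩
    refine exists_continuous_argmax
      (F := fun w : Icc (l i) (u i) × Icc (l (other i)) (u (other i)) => F i w.1 w.2) ?_ ?_
    · exact (hF i).comp_continuous
        (f := fun w : Icc (l i) (u i) × Icc (l (other i)) (u (other i)) =>
          ((w.1 : ℝ), (w.2 : ℝ))) (by fun_prop) fun w => ⟨w.1.2, w.2.2⟩
    · intro y x x' hx hx'
      exact Subtype.ext (huniq i y y.2 x x.2 x' x'.2 (fun z hz => hx ⟨z, hz⟩)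
        fun z hz => hx' ⟨z, hz⟩)
  obtain ⟨g, hgc, hg⟩ := hreply 0
  obtain ⟨h, hhc, hh⟩ := hreply 1
  -- A fixed point of the composite reply of player 0 is needed only in one dimension; `projIcc`
  -- extends this map to all of `ℝ`.
  have hcont : Continuous fun x : ℝ => ((g (h (projIcc (l 0) (u 0) (hlu 0) x)) :
      Icc (l 0) (u 0)) : ℝ) :=
    continuous_subtype_val.comp (hgc.comp (hhc.comp continuous_projIcc))
  obtain ⟨x, hx, hfix⟩ := exists_mem_Icc_isFixedPt_of_mapsTo hcont.continuousOn (hlu 0)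
    fun x _ => (g (h (projIcc (l 0) (u 0) (hlu 0) x))).2
  have hfix' : ((g (h ⟨x, hx⟩) : Icc (l 0) (u 0)) : ℝ) = x := by
    have := hfix.eq
    rwa [projIcc_of_mem _ hx] at this
  refine ⟨![x, h ⟨x, hx⟩], ?_, ?_⟩
  · rw [Fin.forall_fin_two]
    exact ⟨hx, (h ⟨x, hx⟩).2⟩
  · rw [Fin.forall_fin_two]
    refine ⟨fun z hz => ?_, fun z hz => hh ⟨x, hx⟩ ⟨z, hz⟩⟩
    have := hg (h ⟨x, hx⟩) ⟨z, hz⟩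
    rw [hfix'] at this
    exact this

/-! ### Strict concavity and sign of revenue in the capacities -/

theorem strictConcaveOn_comp_affine {s t : Set ℝ} {f : ℝ → ℝ} (hf : StrictConcaveOn ℝ t f)
    (hs : Convex ℝ s) {c d : ℝ} (hc : c ≠ 0) (hmaps : ∀ x ∈ s, c * x + d ∈ t) :
    StrictConcaveOn ℝ s fun x => f (c * x + d) := by
  refine ⟨hs, fun x hx y hy hxy a b ha hb hab => ?_⟩
  have h := hf.2 (hmaps x hx) (hmaps y hy)
    (fun h => hxy (mul_left_cancel₀ hc (add_right_cancel h))) ha hb hab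
  have e : a • (c * x + d) + b • (c * y + d) = c * (a • x + b • y) + d := by
    simp only [smul_eq_mul]
    linear_combination d * hab
  rwa [e] at h

theorem strictConcaveOn_neg_zpow_affine {c d : ℝ} (hc : 0 < c) (hd : 0 < d) {m : ℤ} (hm : m < 0) :
    StrictConcaveOn ℝ (Ici 0) fun x => -(c * x + d) ^ m :=
  strictConcaveOn_comp_affine (f := fun x => -x ^ m)
    (strictConvexOn_zpow hm.ne (by omega)).neg (convex_Ici 0) hc.ne' fun x (hx : 0 ≤ x) => by
      rw [mem_Ioi]; positivity

theorem strictConcaveOn_const_mul {s : Set ℝ} {f : ℝ → ℝ} (hf : StrictConcaveOn ℝ s f) {k : ℝ}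
    (hk : 0 < k) : StrictConcaveOn ℝ s fun x => k * f x := by
  refine ⟨hf.1, fun x hx y hy hxy a b ha hb hab => ?_⟩
  have h := mul_lt_mul_of_pos_left (hf.2 hx hy hxy ha hb hab) hk
  simp only [smul_eq_mul] at h ⊢
  linarith

/-- The equilibrium revenue, in units in which it depends only on the scaled numbers of spots. -/
noncomputable def scaledRevenue (v u : ℝ) : ℝ :=
  (1 + v) * (u * (2 + 2 * u + v) ^ 2) / ((1 + u + v) * (4 + 4 * u + 4 * v + 3 * u * v) ^ 2)

/-- Partial fractions in `u`: a constant minus nonnegative multiples of `1/D₁`, `1/D₂` and `1/D₂²`,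
where `D₁ = 1+u+v` and `D₂ = (4+3v)u + 4(1+v)`. Negative powers are strictly convex, so each term is
concave and the first two are strictly so. -/
theorem strictConcaveOn_scaledRevenue {v : ℝ} (hv : 0 ≤ v) (hv1 : v ≤ 1) :
    StrictConcaveOn ℝ (Ici 0) (scaledRevenue v) := by
  have h1 := strictConcaveOn_const_mul
    (strictConcaveOn_neg_zpow_affine (c := 1) (d := 1 + v) one_pos (by positivity)
      (m := -1) (by norm_num)) (k := 1 / 9) (by norm_num)
  -- The coefficient of `1/D₂`; the only place where `v ≤ 1` is needed.
  have hb : 0 < (80 + 180 * v + 72 * v ^ 2 - 27 * v ^ 3) / (9 * (4 + 3 * v) ^ 2) := by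
    have : v ^ 3 ≤ 1 := pow_le_one₀ hv hv1
    have : 0 < 80 + 180 * v + 72 * v ^ 2 - 27 * v ^ 3 := by nlinarith [sq_nonneg v]
    positivity
  have h2 := strictConcaveOn_const_mul
    (strictConcaveOn_neg_zpow_affine (c := 4 + 3 * v) (d := 4 * (1 + v)) (by positivity)
      (by positivity) (m := -1) (by norm_num)) hb
  have h3 := (strictConcaveOn_neg_zpow_affine (c := 4 + 3 * v) (d := 4 * (1 + v)) (by positivity)
      (by positivity) (m := -2) (by norm_num)).concaveOn.smul
      (c := 4 / 3 * v * (1 + v) * (2 + 3 * v) ^ 2 / (4 + 3 * v) ^ 2) (by positivity)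
  refine (((h1.add h2).add_concaveOn h3).add_const (4 * (1 + v) / (4 + 3 * v) ^ 2)).congr ?_
  intro u (hu : 0 ≤ u)
  have d1' : 1 + u + v ≠ 0 := by positivity
  have d2' : 4 + 4 * u + 4 * v + 3 * u * v ≠ 0 := by positivity
  have e1 : 1 * u + (1 + v) = 1 + u + v := by ring
  have e2 : (4 + 3 * v) * u + 4 * (1 + v) = 4 + 4 * u + 4 * v + 3 * u * v := by ring
  have d3 : 4 + 3 * v ≠ 0 := by positivity
  simp only [Pi.add_apply, scaledRevenue, e1, e2, smul_eq_mul, zpow_neg, zpow_ofNat]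
  field_simp
  ring

/-- By the first-order condition the quantity at equilibrium is proportional to the own price, so
revenue is the squared price times an explicit factor. -/
theorem eqPrice_revenue_eq {W a ε x y : ℝ} (hW : 0 < W) (ha : 0 < a) (hε : 0 < ε) (hx : 0 ≤ x)
    (hy : 0 ≤ y) :
    eqPrice W a ε x y * served W a ε x y (eqPrice W a ε x y) (eqPrice W a ε y x) =
      W / a * scaledRevenue (a * W / ε * y) (a * W / ε * x) := by
  have h := eqPrice_reply hW ha hε hx hy
  have e : served W a ε x y (eqPrice W a ε x y) (eqPrice W a ε y x) =
      x / (a * W * (x + y) + ε) * ((1 + a * W / ε * y) * eqPrice W a ε x y) := by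
    have e' : served W a ε x y (eqPrice W a ε x y) (eqPrice W a ε y x) =
        x / (a * W * (x + y) + ε) * (W + a * W / ε * y * eqPrice W a ε y x -
          (1 + a * W / ε * y) * eqPrice W a ε x y) := by
      unfold served; ring
    rw [e', ← h]; ring
  have e2 : x / (a * W * (x + y) + ε) =
      (a * W / ε * x) / (1 + a * W / ε * x + a * W / ε * y) / (a * W) := by
    have : 0 < a * W * (x + y) + ε := by positivity
    have : 0 < 1 + a * W / ε * x + a * W / ε * y := by positivity
    field_simp
    ring
  rw [e, e2]
  unfold eqPrice scaledRevenue
  have hu : 0 ≤ a * W / ε * x := by positivity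
  have hv : 0 ≤ a * W / ε * y := by positivity
  generalize a * W / ε * x = u at hu
  generalize a * W / ε * y = v at hv
  field_simp

section
variable {W a ε y : ℝ} (hW : 0 < W) (ha : 0 < a) (hε : 0 < ε) (hy : 0 ≤ y)
include hW ha hε hy

theorem strictMonoOn_share : StrictMonoOn (fun x => x / (a * W * (x + y) + ε)) (Ici 0) := by
  intro x hx x' hx' hlt
  have hx : 0 ≤ x := hx
  have hx' : 0 ≤ x' := hx'
  have h : 0 < a * W := mul_pos ha hW
  change x / (a * W * (x + y) + ε) < x' / (a * W * (x' + y) + ε)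
  rw [div_lt_div_iff₀ (by positivity) (by positivity)]
  nlinarith [mul_nonneg (mul_nonneg h.le hy) (sub_nonneg.2 hlt.le),
    mul_pos hε (sub_pos.2 hlt)]

/-- The share is a constant minus a positive multiple of the reciprocal of its denominator. -/
theorem strictConcaveOn_share : StrictConcaveOn ℝ (Ici 0)
    fun x => x / (a * W * (x + y) + ε) := by
  have h1 := strictConcaveOn_const_mul
    (strictConcaveOn_neg_zpow_affine (c := a * W) (d := a * W * y + ε) (by positivity)
      (by positivity) (m := -1) (by norm_num)) (k := (a * W * y + ε) / (a * W)) (by positivity)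
  refine (h1.add_const (1 / (a * W))).congr ?_
  intro x (hx : 0 ≤ x)
  have d1 : a * W * x + (a * W * y + ε) ≠ 0 := by positivity
  have d2 : a * W * (x + y) + ε ≠ 0 := by positivity
  have e : a * W * x + (a * W * y + ε) = a * W * (x + y) + ε := by ring
  simp only [Pi.add_apply, e, zpow_neg, zpow_one]
  field_simp
  ring

end

theorem served_eq_mul_share (W a ε x y c c' : ℝ) :
    served W a ε x y c c' =
      (W * (1 + a * (y / ε) * (c' - c)) - c) * (x / (a * W * (x + y) + ε)) := by
  unfold served; ring

theorem continuousOn_served {W a ε : ℝ} (hW : 0 < W) (ha : 0 < a) (hε : 0 < ε) (c c' : ℝ)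
    {s : Set (ℝ × ℝ)} {f g : ℝ × ℝ → ℝ} (hf : ContinuousOn f s) (hg : ContinuousOn g s)
    (hf0 : ∀ w ∈ s, 0 ≤ f w) (hg0 : ∀ w ∈ s, 0 ≤ g w) :
    ContinuousOn (fun w => served W a ε (f w) (g w) c c') s := by
  unfold served
  refine ContinuousOn.div (by fun_prop) (by fun_prop) fun w hw => ?_
  have := hf0 w hw
  have := hg0 w hw
  positivity

theorem continuousOn_scaledRevenue {s : Set (ℝ × ℝ)} {f g : ℝ × ℝ → ℝ} (hf : ContinuousOn f s)
    (hg : ContinuousOn g s) (hf0 : ∀ w ∈ s, 0 ≤ f w) (hg0 : ∀ w ∈ s, 0 ≤ g w) :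
    ContinuousOn (fun w => scaledRevenue (g w) (f w)) s := by
  unfold scaledRevenue
  refine ContinuousOn.div (by fun_prop) (by fun_prop) fun w hw => ?_
  have := hf0 w hw
  have := hg0 w hw
  positivity

/-- At the equilibrium prices for `x` and `y` spots, a firm with spots attracts drivers also when
the opponent offers fewer spots. -/
theorem eqPrice_attraction_pos {W a ε x y y' : ℝ} (hW : 0 < W) (ha : 0 < a) (hε : 0 < ε)
    (hx : 0 ≤ x) (hy' : 0 ≤ y') (hyy' : y' ≤ y) :
    0 < W * (1 + a * (y' / ε) * (eqPrice W a ε y x - eqPrice W a ε x y)) - eqPrice W a ε x y := by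
  have hy : 0 ≤ y := hy'.trans hyy'
  have h1 := eqPrice_lt hW ha hε hx hy
  have h2 := eqPrice_pos hW ha hε hx hy
  have h3 := eqPrice_reply hW ha hε hx hy
  have hA : 0 < a * W / ε := by positivity
  generalize eqPrice W a ε x y = c at *
  generalize eqPrice W a ε y x = c' at *
  have e : W * (1 + a * (y' / ε) * (c' - c)) - c = W - c + a * W / ε * y' * (c' - c) := by
    field_simp; ring
  rw [e]
  generalize a * W / ε = A at *
  rcases le_total c c' with h | h
  · have := mul_nonneg (mul_nonneg hA.le hy') (sub_nonneg.2 h)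
    linarith
  -- Fewer rival spots help the dearer firm, and for `y' = y` the expression equals `(1 + Ay)c` by
  -- the first-order condition.
  · have k1 : A * y * (c - c') ≥ A * y' * (c - c') := by gcongr
    have k2 : 0 ≤ A * y * c := by positivity
    nlinarith

/-! ### Reduction of subgame perfection to subgames and capacities -/

namespace Market

variable {M : Market}

theorem We_pos (M : Market) : 0 < M.We := M.Wd_pos.trans M.Wd_lt_We

theorem spots_nonneg (M : Market) : ∀ i, 0 ≤ M.spots i := by
  rw [Fin.forall_fin_two]
  exact ⟨M.δ_nonneg, sub_nonneg.2 M.δ_le_one⟩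

theorem spots_le_one (M : Market) : ∀ i, M.spots i ≤ 1 := by
  rw [Fin.forall_fin_two]
  exact ⟨M.δ_le_one, sub_le_self _ M.δ_nonneg⟩

theorem mandate_le_spots (M : Market) (i : Fin 2) : M.r * M.spots i ≤ M.spots i :=
  mul_le_of_le_one_left (M.spots_nonneg i) M.r_le_one

theorem mem_capacitySet_optimalCapacity {i : Fin 2} {x : ℝ} :
    x ∈ M.capacitySet .optimalCapacity i ↔ x ∈ Icc (M.r * M.spots i) (M.spots i) := by
  have := mul_nonneg M.r_nonneg (M.spots_nonneg i)
  constructor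
  · rintro ⟨-, h1, h2⟩
    exact ⟨h2, by linarith⟩
  · rintro ⟨h1, h2⟩
    exact ⟨by linarith, by linarith, h1⟩

theorem capacity_bounds {k : CapacityRule} {i : Fin 2} {x : ℝ} (hx : x ∈ M.capacitySet k i) :
    0 ≤ x ∧ 0 ≤ M.spots i - x := by
  cases k with
  | naiveMandate =>
    obtain rfl : x = M.r * M.spots i := hx
    exact ⟨mul_nonneg M.r_nonneg (M.spots_nonneg i), sub_nonneg.2 (M.mandate_le_spots i)⟩
  | optimalCapacity => exact ⟨hx.1, hx.2.1⟩

instance : Subsingleton (M.Capacities .naiveMandate) :=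
  ⟨fun n n' => funext fun i => Subtype.ext ((n i).2.trans (n' i).2.symm)⟩

/-- Profit of firm `i` with `x` EV spots and tariff `τ` when the opponent has `y` EV spots and
tariff `τ'`. -/
noncomputable def firmProfit (M : Market) (i : Fin 2) (x y : ℝ) (τ τ' : Tariff) : ℝ :=
  τ.ice * served M.Wd M.β M.ε (M.spots i - x) (M.spots (other i) - y) τ.ice τ'.ice +
    τ.ev * served M.We M.α M.ε x y τ.ev τ'.ev - M.p * x

variable {k : CapacityRule} {c : PricingScheme}

theorem subgameProfit_eq (n : M.Capacities k) (t : ∀ i, M.admissibleTariffs c i) (i : Fin 2) :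
    subgameProfit n t i =
      M.firmProfit i (n i) (n (other i)) (t i : Tariff) (t (other i) : Tariff) := rfl

theorem subgameProfit_update (n : M.Capacities k) (t : ∀ i, M.admissibleTariffs c i) (i : Fin 2)
    (τ : M.admissibleTariffs c i) :
    subgameProfit n (Function.update t i τ) i =
      M.firmProfit i (n i) (n (other i)) (τ : Tariff) (t (other i) : Tariff) := by
  rw [subgameProfit_eq, Function.update_self, Function.update_of_ne (other_ne i)]

/-- Equilibrium tariffs of all subgames together with equilibrium capacities of the reduced game
form a subgame-perfect equilibrium. -/
theorem exists_isSPNE (t : ∀ i, M.Capacities k → M.admissibleTariffs c i) (n : M.Capacities k)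
    (hsub : ∀ (n : M.Capacities k) (i : Fin 2) (τ : M.admissibleTariffs c i),
      M.firmProfit i (n i) (n (other i)) (τ : Tariff) (t (other i) n : Tariff) ≤
        M.firmProfit i (n i) (n (other i)) (t i n : Tariff) (t (other i) n : Tariff))
    (hcap : ∀ (i : Fin 2) (x : M.capacitySet k i),
      subgameProfit (Function.update n i x) (fun j => t j (Function.update n i x)) i ≤
        subgameProfit n (fun j => t j n) i) :
    ∃ s : M.Profile k c, s.IsSPNE := by
  refine ⟨fun i => ⟨n i, t i⟩, fun n i τ => ?_, fun i s' => ?_⟩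
  · rw [subgameProfit_update, subgameProfit_eq]
    exact hsub n i τ
  -- In the subgame reached by the deviation, reverting to the tariff `t` cannot lower the profit;
  -- what remains is a pure capacity deviation.
  · refine le_trans ?_ (hcap i s'.capacity)
    have hn : Profile.capacities (Function.update (fun i => (⟨n i, t i⟩ : M.Strategy k c i)) i s') =
        Function.update n i s'.capacity := by
      funext j
      by_cases hj : j = i
      · subst hj; simp [Profile.capacities]
      · simp [Profile.capacities, hj]
    have hp : Profile.payoff (Function.update (fun i => (⟨n i, t i⟩ : M.Strategy k c i)) i s') i =
        subgameProfit (Function.update n i s'.capacity)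
          (Function.update (fun j => t j (Function.update n i s'.capacity)) i
            (s'.tariff (Function.update n i s'.capacity))) i := by
      unfold Profile.payoff
      rw [hn]
      congr 1
      funext j
      by_cases hj : j = i
      · subst hj; simp
      · simp [hj]
    rw [hp, subgameProfit_update, subgameProfit_eq]
    exact hsub _ i _

theorem exists_isSPNE_naiveMandate (t : ∀ i, M.Capacities .naiveMandate → M.admissibleTariffs c i)
    (hsub : ∀ (n : M.Capacities .naiveMandate) (i : Fin 2) (τ : M.admissibleTariffs c i),
      M.firmProfit i (n i) (n (other i)) (τ : Tariff) (t (other i) n : Tariff) ≤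
        M.firmProfit i (n i) (n (other i)) (t i n : Tariff) (t (other i) n : Tariff)) :
    ∃ s : M.Profile .naiveMandate c, s.IsSPNE :=
  exists_isSPNE t (fun i => ⟨M.r * M.spots i, rfl⟩) hsub fun i _ =>
    (congrArg (fun n => subgameProfit n (fun j => t j n) i) (Subsingleton.elim _ _)).le

theorem Profile.IsSPNE.firmProfit_le {s : M.Profile k c} (hs : s.IsSPNE) (n : M.Capacities k)
    (i : Fin 2) (τ : M.admissibleTariffs c i) :
    M.firmProfit i (n i) (n (other i)) (τ : Tariff) ((s (other i)).tariff n : Tariff) ≤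
      M.firmProfit i (n i) (n (other i)) ((s i).tariff n : Tariff)
        ((s (other i)).tariff n : Tariff) := by
  have h := hs.1 n i τ
  rwa [subgameProfit_update, subgameProfit_eq] at h

/-! ### Two prices under the naive mandate -/

/-- Two-price tariffs composed of the equilibrium prices of both classes. -/
noncomputable def twoPriceTariff (M : Market) (i : Fin 2) (x y : ℝ) : Tariff where
  ev := eqPrice M.We M.α M.ε x y
  ice := eqPrice M.Wd M.β M.ε (M.spots i - x) (M.spots (other i) - y)

theorem coe_other_other (n : M.Capacities k) (i : Fin 2) : (n (other (other i)) : ℝ) = n i := by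
  fin_cases i <;> rfl

theorem firmProfit_le_twoPriceTariff (n : M.Capacities k) (i : Fin 2) (τ : Tariff) :
    M.firmProfit i (n i) (n (other i)) τ
        (M.twoPriceTariff (other i) (n (other i)) (n (other (other i)))) ≤
      M.firmProfit i (n i) (n (other i)) (M.twoPriceTariff i (n i) (n (other i)))
        (M.twoPriceTariff (other i) (n (other i)) (n (other (other i)))) := by
  have hi := capacity_bounds (n i).2
  have hj := capacity_bounds (n (other i)).2
  have h1 := revenue_le_eqPrice M.We_pos M.α_pos M.ε_pos hi.1 hj.1 τ.ev
  have h2 := revenue_le_eqPrice M.Wd_pos M.β_pos M.ε_pos hi.2 hj.2 τ.ice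
  simp only [firmProfit, twoPriceTariff, other_other, coe_other_other]
  linarith

theorem exists_isSPNE_twoPrice_naiveMandate :
    ∃ s : M.Profile .naiveMandate .twoPrice, s.IsSPNE :=
  exists_isSPNE_naiveMandate
    (fun i n => ⟨M.twoPriceTariff i (n i) (n (other i)), mem_univ _⟩) fun n i τ =>
      firmProfit_le_twoPriceTariff n i τ

/-- Deviating in one price only cancels the revenue from the other class, so each class is in a
revenue equilibrium of its own. -/
theorem agreeOnSpots_twoPrice {s s' : M.Profile .naiveMandate .twoPrice} (hs : s.IsSPNE)
    (hs' : s'.IsSPNE) : s.AgreeOnSpots s' := by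
  intro i
  refine ⟨Subtype.ext ((s i).capacity.2.trans (s' i).capacity.2.symm), fun n => ⟨fun hi => ?_,
    fun hi => ?_⟩⟩
  · have ev : ∀ {s : M.Profile .naiveMandate .twoPrice}, s.IsSPNE → ∀ i z,
        z * served M.We M.α M.ε (n i) (n (other i)) z ((s (other i)).tariff n : Tariff).ev ≤
          ((s i).tariff n : Tariff).ev * served M.We M.α M.ε (n i) (n (other i))
            ((s i).tariff n : Tariff).ev ((s (other i)).tariff n : Tariff).ev := fun {s} hs i z => by
      have h := hs.firmProfit_le n i ⟨⟨z, ((s i).tariff n : Tariff).ice⟩, mem_univ _⟩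
      simp only [firmProfit] at h
      linarith
    exact revenue_equilibrium_unique M.We_pos M.α_pos M.ε_pos (N := fun j => (n j : ℝ))
      (c := fun j => ((s j).tariff n : Tariff).ev) (c' := fun j => ((s' j).tariff n : Tariff).ev)
      (fun j => (capacity_bounds (n j).2).1) (ev hs) (ev hs') hi
  · have ice : ∀ {s : M.Profile .naiveMandate .twoPrice}, s.IsSPNE → ∀ i z,
        z * served M.Wd M.β M.ε (M.spots i - n i) (M.spots (other i) - n (other i)) z
            ((s (other i)).tariff n : Tariff).ice ≤
          ((s i).tariff n : Tariff).ice *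
            served M.Wd M.β M.ε (M.spots i - n i) (M.spots (other i) - n (other i))
              ((s i).tariff n : Tariff).ice ((s (other i)).tariff n : Tariff).ice :=
      fun {s} hs i z => by
        have h := hs.firmProfit_le n i ⟨⟨((s i).tariff n : Tariff).ev, z⟩, mem_univ _⟩
        simp only [firmProfit] at h
        linarith
    exact revenue_equilibrium_unique M.Wd_pos M.β_pos M.ε_pos
      (N := fun j => M.spots j - (n j : ℝ))
      (c := fun j => ((s j).tariff n : Tariff).ice) (c' := fun j => ((s' j).tariff n : Tariff).ice)
      (fun j => (capacity_bounds (n j).2).2) (ice hs) (ice hs') hi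

/-! ### Optimal single price under the naive mandate -/

/-- Total quantity served at zero prices by firm `i` with `x` EV spots. -/
noncomputable def totalAtZero (M : Market) (i : Fin 2) (x y : ℝ) : ℝ :=
  servedAtZero M.Wd M.β M.ε (M.spots i - x) (M.spots (other i) - y) +
    servedAtZero M.We M.α M.ε x y

/-- Sensitivity of the total quantity to the single price of the opponent. -/
noncomputable def totalCross (M : Market) (i : Fin 2) (x y : ℝ) : ℝ :=
  crossSlope M.Wd M.β M.ε (M.spots i - x) (M.spots (other i) - y) + crossSlope M.We M.α M.ε x y

/-- Sensitivity of the total quantity to the own single price. -/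
noncomputable def totalOwn (M : Market) (i : Fin 2) (x y : ℝ) : ℝ :=
  ownSlope M.Wd M.β M.ε (M.spots i - x) (M.spots (other i) - y) + ownSlope M.We M.α M.ε x y

theorem firmProfit_single (i : Fin 2) (x y : ℝ) {τ τ' : Tariff} (hτ : τ.ev = τ.ice)
    (hτ' : τ'.ev = τ'.ice) :
    M.firmProfit i x y τ τ' =
      τ.ice * (M.totalAtZero i x y + M.totalCross i x y * τ'.ice - M.totalOwn i x y * τ.ice) -
        M.p * x := by
  simp only [firmProfit, served_eq, hτ, hτ', totalAtZero, totalCross, totalOwn]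
  ring

section
variable {n : Fin 2 → ℝ} (hn : ∀ i, 0 ≤ n i ∧ 0 ≤ M.spots i - n i)
include hn

theorem totalCross_nonneg (i : Fin 2) : 0 ≤ M.totalCross i (n i) (n (other i)) :=
  add_nonneg (crossSlope_nonneg M.Wd_pos M.β_pos M.ε_pos (hn _).2 (hn _).2)
    (crossSlope_nonneg M.We_pos M.α_pos M.ε_pos (hn _).1 (hn _).1)

theorem totalCross_le_totalOwn (i : Fin 2) :
    M.totalCross i (n i) (n (other i)) ≤ M.totalOwn i (n i) (n (other i)) :=
  add_le_add (crossSlope_le_ownSlope M.Wd_pos M.β_pos M.ε_pos (hn _).2 (hn _).2)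
    (crossSlope_le_ownSlope M.We_pos M.α_pos M.ε_pos (hn _).1 (hn _).1)

theorem totalOwn_pos {i : Fin 2} (hi : 0 < M.spots i) :
    0 < M.totalOwn i (n i) (n (other i)) := by
  rcases (hn i).1.eq_or_lt with h | h
  · refine add_pos_of_pos_of_nonneg
      (ownSlope_pos M.Wd_pos M.β_pos M.ε_pos (hn _).2 (hn _).2 (by linarith))
      (ownSlope_nonneg M.We_pos M.α_pos M.ε_pos (hn _).1 (hn _).1)
  · exact add_pos_of_nonneg_of_pos
      (ownSlope_nonneg M.Wd_pos M.β_pos M.ε_pos (hn _).2 (hn _).2)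
      (ownSlope_pos M.We_pos M.α_pos M.ε_pos (hn _).1 (hn _).1 h)

/-- A vanishing own slope means no spots of either class. This supplies the degenerate case of
`forall_mul_sub_le_iff` and `exists_firstOrder`. -/
theorem total_eq_zero_of_totalOwn_eq_zero {i : Fin 2}
    (h : M.totalOwn i (n i) (n (other i)) = 0) :
    M.totalAtZero i (n i) (n (other i)) = 0 ∧ M.totalCross i (n i) (n (other i)) = 0 := by
  have h0 : M.spots i = 0 := by
    by_contra hne
    exact (totalOwn_pos hn (lt_of_le_of_ne (M.spots_nonneg i) (Ne.symm hne))).ne' h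
  have h1 : n i = 0 := by
    have := hn i
    exact le_antisymm (by linarith) this.1
  simp [totalAtZero, totalCross, servedAtZero, crossSlope, h0, h1]

theorem single_price_optimal_iff {i : Fin 2} {z z' : ℝ} :
    (∀ x, x * (M.totalAtZero i (n i) (n (other i)) + M.totalCross i (n i) (n (other i)) * z' -
        M.totalOwn i (n i) (n (other i)) * x) ≤
      z * (M.totalAtZero i (n i) (n (other i)) + M.totalCross i (n i) (n (other i)) * z' -
        M.totalOwn i (n i) (n (other i)) * z)) ↔
    2 * M.totalOwn i (n i) (n (other i)) * z =
      M.totalAtZero i (n i) (n (other i)) + M.totalCross i (n i) (n (other i)) * z' :=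
  forall_mul_sub_le_iff ((totalCross_nonneg hn i).trans (totalCross_le_totalOwn hn i)) fun h => by
    rw [(total_eq_zero_of_totalOwn_eq_zero hn h).1, (total_eq_zero_of_totalOwn_eq_zero hn h).2]
    ring

end

theorem totalCross_eq (n : Fin 2 → ℝ) :
    ∀ i, M.totalCross i (n i) (n (other i)) = M.totalCross 0 (n 0) (n 1) := by
  rw [Fin.forall_fin_two]
  refine ⟨rfl, ?_⟩
  simp only [totalCross, other_one, other_zero]
  rw [crossSlope_comm, crossSlope_comm M.We]

theorem exists_isSPNE_optimalSingle_naiveMandate :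
    ∃ s : M.Profile .naiveMandate .optimalSingle, s.IsSPNE := by
  have hex : ∀ n : M.Capacities .naiveMandate, ∃ z : Fin 2 → ℝ, ∀ i,
      2 * M.totalOwn i (n i) (n (other i)) * z i = M.totalAtZero i (n i) (n (other i)) +
        M.totalCross i (n i) (n (other i)) * z (other i) := by
    intro n
    have hn : ∀ i, 0 ≤ (n i : ℝ) ∧ 0 ≤ M.spots i - n i := fun i => capacity_bounds (n i).2
    have hQ := totalCross_eq (M := M) fun j => (n j : ℝ)
    obtain ⟨z, hz⟩ := exists_firstOrder (P := fun i => M.totalAtZero i (n i) (n (other i)))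
      (S := fun i => M.totalOwn i (n i) (n (other i))) (Q := M.totalCross 0 (n 0) (n 1))
      (totalCross_nonneg hn 0) (fun i => (hQ i) ▸ totalCross_le_totalOwn hn i)
      fun i h => (total_eq_zero_of_totalOwn_eq_zero hn h).1
    exact ⟨z, fun i => by rw [hQ i]; exact hz i⟩
  choose z hz using hex
  refine exists_isSPNE_naiveMandate (fun i n => ⟨⟨z n i, z n i⟩, rfl⟩) fun n i τ => ?_
  rw [firmProfit_single i _ _ τ.2 rfl, firmProfit_single i _ _ rfl rfl]
  exact sub_le_sub_right ((single_price_optimal_iff (n := fun j => (n j : ℝ))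
    fun i => capacity_bounds (n i).2).2 (hz n i) _) _

theorem agreeOnSpots_optimalSingle {s s' : M.Profile .naiveMandate .optimalSingle} (hs : s.IsSPNE)
    (hs' : s'.IsSPNE) : s.AgreeOnSpots s' := by
  intro i
  refine ⟨Subtype.ext ((s i).capacity.2.trans (s' i).capacity.2.symm), fun n => ?_⟩
  have hn : ∀ i, 0 ≤ (n i : ℝ) ∧ 0 ≤ M.spots i - n i := fun i => capacity_bounds (n i).2
  have hQ := totalCross_eq (M := M) fun j => (n j : ℝ)
  have foc : ∀ {s : M.Profile .naiveMandate .optimalSingle}, s.IsSPNE → ∀ i,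
      2 * M.totalOwn i (n i) (n (other i)) * ((s i).tariff n : Tariff).ice =
        M.totalAtZero i (n i) (n (other i)) +
          M.totalCross 0 (n 0) (n 1) * ((s (other i)).tariff n : Tariff).ice := by
    intro s hs i
    rw [← hQ i]
    refine (single_price_optimal_iff hn).1 fun x => ?_
    have h := hs.firmProfit_le n i ⟨⟨x, x⟩, rfl⟩
    rw [firmProfit_single i _ _ rfl ((s (other i)).tariff n).2,
      firmProfit_single i _ _ ((s i).tariff n).2 ((s (other i)).tariff n).2] at h
    simpa using h
  have hice : 0 < M.spots i →
      ((s i).tariff n : Tariff).ice = ((s' i).tariff n : Tariff).ice := fun hi =>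
    firstOrder_unique (P := fun i => M.totalAtZero i (n i) (n (other i)))
      (S := fun i => M.totalOwn i (n i) (n (other i))) (Q := M.totalCross 0 (n 0) (n 1))
      (z := fun j => ((s j).tariff n : Tariff).ice) (z' := fun j => ((s' j).tariff n : Tariff).ice)
      (totalCross_nonneg hn 0) (fun i => (hQ i) ▸ totalCross_le_totalOwn hn i)
      (foc hs) (foc hs') (totalOwn_pos hn hi)
  have hev : ∀ s : M.Profile .naiveMandate .optimalSingle,
      ((s i).tariff n : Tariff).ev = ((s i).tariff n : Tariff).ice := fun s => ((s i).tariff n).2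
  have hi := hn i
  rw [hev s, hev s']
  exact ⟨fun h => hice (by linarith), fun h => hice (by linarith)⟩

/-! ### Naive single price under the naive mandate -/

theorem isPreEVEquilibrium_iff {m : Fin 2 → ℝ} : M.IsPreEVEquilibrium m ↔ ∀ i z,
    z * served M.Wd M.β M.ε (M.spots i) (M.spots (other i)) z (m (other i)) ≤
      m i * served M.Wd M.β M.ε (M.spots i) (M.spots (other i)) (m i) (m (other i)) := by
  refine forall₂_congr fun i z => ?_
  simp only [preEVRevenue, quantity_eq_served, Function.update_self,
    Function.update_of_ne (other_ne i)]

/-- Prices of the equilibrium without chargers. -/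
noncomputable def preEVPrice (M : Market) (i : Fin 2) : ℝ :=
  eqPrice M.Wd M.β M.ε (M.spots i) (M.spots (other i))

theorem isPreEVEquilibrium_preEVPrice : M.IsPreEVEquilibrium M.preEVPrice := by
  rw [isPreEVEquilibrium_iff]
  intro i z
  have := revenue_le_eqPrice M.Wd_pos M.β_pos M.ε_pos (M.spots_nonneg i)
    (M.spots_nonneg (other i)) z
  simpa only [preEVPrice, other_other] using this

/-- The tariff that keeps the equilibrium price of the market without chargers. -/
noncomputable def naiveTariff (M : Market) (i : Fin 2) : M.admissibleTariffs .naiveSingle i :=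
  ⟨⟨M.preEVPrice i, M.preEVPrice i⟩, rfl, M.preEVPrice, isPreEVEquilibrium_preEVPrice, rfl⟩

theorem eq_naiveTariff {i : Fin 2} (hi : 0 < M.spots i) (τ : M.admissibleTariffs .naiveSingle i) :
    τ = M.naiveTariff i := by
  obtain ⟨⟨ev, ice⟩, h, m, hm, hmi⟩ := τ
  have h' : m i = M.preEVPrice i := revenue_equilibrium_unique M.Wd_pos M.β_pos M.ε_pos
    M.spots_nonneg (isPreEVEquilibrium_iff.1 hm)
    (isPreEVEquilibrium_iff.1 isPreEVEquilibrium_preEVPrice) hi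
  have hice : ice = M.preEVPrice i := hmi.symm.trans h'
  exact Subtype.ext (Tariff.ext (h.trans hice) hice)

/-- A firm with spots has no other admissible tariff; a firm without spots earns zero at any price.
-/
theorem firmProfit_le_naiveTariff (n : M.Capacities k) (i : Fin 2)
    (τ : M.admissibleTariffs .naiveSingle i) (τ' : Tariff) :
    M.firmProfit i (n i) (n (other i)) (τ : Tariff) τ' ≤
      M.firmProfit i (n i) (n (other i)) (M.naiveTariff i : Tariff) τ' := by
  rcases (M.spots_nonneg i).eq_or_lt with hi | hi
  · have h := capacity_bounds (n i).2
    have h0 : (n i : ℝ) = 0 := le_antisymm (by linarith) h.1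
    simp [firmProfit, ← hi, h0, served_zero]
  · rw [eq_naiveTariff hi τ]

theorem exists_isSPNE_naiveSingle_naiveMandate :
    ∃ s : M.Profile .naiveMandate .naiveSingle, s.IsSPNE :=
  exists_isSPNE_naiveMandate (fun i _ => M.naiveTariff i) fun n i τ =>
    firmProfit_le_naiveTariff n i τ _

theorem agreeOnSpots_naiveSingle (s s' : M.Profile .naiveMandate .naiveSingle) :
    s.AgreeOnSpots s' := by
  intro i
  refine ⟨Subtype.ext ((s i).capacity.2.trans (s' i).capacity.2.symm), fun n => ?_⟩
  have hi := capacity_bounds (n i).2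
  have heq : 0 < M.spots i → (s i).tariff n = (s' i).tariff n := fun h =>
    (eq_naiveTariff h _).trans (eq_naiveTariff h _).symm
  exact ⟨fun h => by rw [heq (by linarith)], fun h => by rw [heq (by linarith)]⟩

/-! ### Existence and uniqueness under the naive mandate -/

/-- Profiles that agree on spots are equal if every firm has spots and, for the two-price scheme,
spots of both classes. -/
theorem Profile.AgreeOnSpots.eq {s s' : M.Profile .naiveMandate c} (h : s.AgreeOnSpots s')
    (hspots : ∀ i, 0 < M.spots i) (hr : c = .twoPrice → 0 < M.r ∧ M.r < 1) : s = s' := by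
  funext i
  refine Strategy.ext (h i).1 (funext fun n => Subtype.ext ?_)
  obtain ⟨hev, hice⟩ := (h i).2 n
  have hni : (n i : ℝ) = M.r * M.spots i := (n i).2
  have hi := hspots i
  -- With a common price, spots of either class pin down both components.
  have single : (∀ t : M.admissibleTariffs c i, (t : Tariff).ev = (t : Tariff).ice) →
      ((s i).tariff n : Tariff) = (s' i).tariff n := by
    intro hc
    have h1 := hc ((s i).tariff n)
    have h2 := hc ((s' i).tariff n)
    rcases (capacity_bounds (n i).2).1.eq_or_lt with h0 | h0
    · have := hice (by linarith)
      exact Tariff.ext (by rw [h1, h2, this]) this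
    · have := hev h0
      exact Tariff.ext this (by rw [← h1, ← h2, this])
  cases c with
  | twoPrice =>
    obtain ⟨hr0, hr1⟩ := hr rfl
    exact Tariff.ext (hev (by rw [hni]; positivity)) (hice (by rw [hni]; nlinarith))
  | optimalSingle => exact single fun t => t.2
  | naiveSingle => exact single fun t => t.2.1

theorem agreeOnSpots_of_isSPNE {s s' : M.Profile .naiveMandate c} (hs : s.IsSPNE)
    (hs' : s'.IsSPNE) : s.AgreeOnSpots s' := by
  cases c with
  | twoPrice => exact agreeOnSpots_twoPrice hs hs'
  | optimalSingle => exact agreeOnSpots_optimalSingle hs hs'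
  | naiveSingle => exact agreeOnSpots_naiveSingle s s'

theorem exists_isSPNE_of_naiveMandate (c : PricingScheme) :
    ∃ s : M.Profile .naiveMandate c, s.IsSPNE := by
  cases c with
  | twoPrice => exact exists_isSPNE_twoPrice_naiveMandate
  | optimalSingle => exact exists_isSPNE_optimalSingle_naiveMandate
  | naiveSingle => exact exists_isSPNE_naiveSingle_naiveMandate

/-! ### Optimal capacity -/

/-- Equilibrium tariffs that depend on the capacities through `T` extend to a subgame-perfect
equilibrium if the reduced capacity game is continuous with unique best replies. -/
theorem exists_isSPNE_optimalCapacity (T : ∀ i, ℝ → ℝ → M.admissibleTariffs c i)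
    (hsub : ∀ (n : M.Capacities .optimalCapacity) (i : Fin 2) (τ : M.admissibleTariffs c i),
      M.firmProfit i (n i) (n (other i)) (τ : Tariff)
          (T (other i) (n (other i)) (n (other (other i))) : Tariff) ≤
        M.firmProfit i (n i) (n (other i)) (T i (n i) (n (other i)) : Tariff)
          (T (other i) (n (other i)) (n (other (other i))) : Tariff))
    {F : Fin 2 → ℝ → ℝ → ℝ}
    (hT : ∀ i, ∀ x ∈ Icc (M.r * M.spots i) (M.spots i),
      ∀ y ∈ Icc (M.r * M.spots (other i)) (M.spots (other i)),
      M.firmProfit i x y (T i x y : Tariff) (T (other i) y x : Tariff) = F i x y)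
    (hF : ∀ i, ContinuousOn (fun w : ℝ × ℝ => F i w.1 w.2)
      (Icc (M.r * M.spots i) (M.spots i) ×ˢ
        Icc (M.r * M.spots (other i)) (M.spots (other i))))
    (huniq : ∀ i, ∀ y ∈ Icc (M.r * M.spots (other i)) (M.spots (other i)),
      StrictConcaveOn ℝ (Icc (M.r * M.spots i) (M.spots i)) (fun z => F i z y) ∨
        StrictAntiOn (fun z => F i z y) (Icc (M.r * M.spots i) (M.spots i))) :
    ∃ s : M.Profile .optimalCapacity c, s.IsSPNE := by
  obtain ⟨n, hn, hmax⟩ := exists_nash_of_unique_replies M.mandate_le_spots hF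
    fun i y hy x hx x' hx' hm hm' => by
      rcases huniq i y hy with h | h
      · exact h.eq_of_isMaxOn hm hm' hx hx'
      · exact h.injOn hx hx' (le_antisymm (hm' hx) (hm hx'))
  refine exists_isSPNE (fun i n => T i (n i) (n (other i)))
    (fun i => ⟨n i, mem_capacitySet_optimalCapacity.2 (hn i)⟩) hsub fun i x => ?_
  have hx := mem_capacitySet_optimalCapacity.1 x.2
  have h := hmax i x hx
  rw [← hT i x hx _ (hn _), ← hT i _ (hn i) _ (hn _)] at h
  simp only [subgameProfit_eq, coe_other_other, Function.update_self,
    Function.update_of_ne (other_ne i), other_other]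
  exact h

theorem exists_isSPNE_twoPrice_optimalCapacity (he : M.α * M.We / M.ε ≤ 1)
    (hd : M.β * M.Wd / M.ε ≤ 1) : ∃ s : M.Profile .optimalCapacity .twoPrice, s.IsSPNE := by
  have hA : 0 < M.α * M.We / M.ε := div_pos (mul_pos M.α_pos M.We_pos) M.ε_pos
  have hB : 0 < M.β * M.Wd / M.ε := div_pos (mul_pos M.β_pos M.Wd_pos) M.ε_pos
  have hbd : ∀ i, ∀ x ∈ Icc (M.r * M.spots i) (M.spots i),
      0 ≤ x ∧ 0 ≤ M.spots i - x := fun i x hx =>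
    capacity_bounds (mem_capacitySet_optimalCapacity.2 hx)
  refine exists_isSPNE_optimalCapacity (fun i x y => ⟨M.twoPriceTariff i x y, mem_univ _⟩)
    (fun n i τ => firmProfit_le_twoPriceTariff n i τ)
    (F := fun i x y => M.Wd / M.β * scaledRevenue (M.β * M.Wd / M.ε * (M.spots (other i) - y))
      (M.β * M.Wd / M.ε * (M.spots i - x)) +
      M.We / M.α * scaledRevenue (M.α * M.We / M.ε * y) (M.α * M.We / M.ε * x) - M.p * x)
    ?_ ?_ ?_
  · intro i x hx y hy
    obtain ⟨hx0, hx1⟩ := hbd i x hx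
    obtain ⟨hy0, hy1⟩ := hbd _ y hy
    simp only [firmProfit, twoPriceTariff, other_other]
    rw [eqPrice_revenue_eq M.Wd_pos M.β_pos M.ε_pos hx1 hy1,
      eqPrice_revenue_eq M.We_pos M.α_pos M.ε_pos hx0 hy0]
  · intro i
    have c1 := continuousOn_scaledRevenue
      (s := Icc (M.r * M.spots i) (M.spots i) ×ˢ
        Icc (M.r * M.spots (other i)) (M.spots (other i)))
      (f := fun w => M.β * M.Wd / M.ε * (M.spots i - w.1))
      (g := fun w => M.β * M.Wd / M.ε * (M.spots (other i) - w.2)) (by fun_prop) (by fun_prop)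
      (fun w hw => mul_nonneg hB.le (hbd _ _ hw.1).2)
      fun w hw => mul_nonneg hB.le (hbd _ _ hw.2).2
    have c2 := continuousOn_scaledRevenue
      (s := Icc (M.r * M.spots i) (M.spots i) ×ˢ
        Icc (M.r * M.spots (other i)) (M.spots (other i)))
      (f := fun w => M.α * M.We / M.ε * w.1)
      (g := fun w => M.α * M.We / M.ε * w.2) (by fun_prop) (by fun_prop)
      (fun w hw => mul_nonneg hA.le (hbd _ _ hw.1).1)
      fun w hw => mul_nonneg hA.le (hbd _ _ hw.2).1
    exact ((continuousOn_const.mul c1).add (continuousOn_const.mul c2)).sub (by fun_prop)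
  · intro i y hy
    left
    obtain ⟨hy0, hy1⟩ := hbd _ y hy
    have hN := M.spots_le_one (other i)
    -- No firm owns more than the unit mass of spots, so the opponent's scaled capacity is at most 1
    -- in both classes.
    have k1 := strictConcaveOn_comp_affine
      (strictConcaveOn_scaledRevenue (v := M.β * M.Wd / M.ε * (M.spots (other i) - y))
        (by positivity) (mul_le_one₀ hd hy1 (by linarith)))
      (convex_Icc (M.r * M.spots i) (M.spots i)) (c := -(M.β * M.Wd / M.ε))
      (d := M.β * M.Wd / M.ε * M.spots i) (neg_ne_zero.2 hB.ne') fun x hx => by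
        have := mul_nonneg hB.le (hbd _ _ hx).2
        rw [mem_Ici]; linarith
    have k2 := strictConcaveOn_comp_affine
      (strictConcaveOn_scaledRevenue (v := M.α * M.We / M.ε * y)
        (by positivity) (mul_le_one₀ he hy0 (by linarith)))
      (convex_Icc (M.r * M.spots i) (M.spots i)) (c := M.α * M.We / M.ε)
      (d := 0) hA.ne' fun x hx => by
        have := mul_nonneg hA.le (hbd _ _ hx).1
        rw [mem_Ici]; linarith
    have k3 : ConcaveOn ℝ (Icc (M.r * M.spots i) (M.spots i)) fun x => -(M.p * x) :=
      ⟨convex_Icc _ _, fun x _ y _ a b _ _ _ => le_of_eq (by simp only [smul_eq_mul]; ring)⟩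
    refine (((strictConcaveOn_const_mul k1 (div_pos M.Wd_pos M.β_pos)).add
      (strictConcaveOn_const_mul k2 (div_pos M.We_pos M.α_pos))).add_concaveOn k3).congr ?_
    intro x _
    simp only [Pi.add_apply]
    rw [show -(M.β * M.Wd / M.ε) * x + M.β * M.Wd / M.ε * M.spots i =
      M.β * M.Wd / M.ε * (M.spots i - x) by ring, add_zero]
    ring

theorem exists_isSPNE_naiveSingle_optimalCapacity :
    ∃ s : M.Profile .optimalCapacity .naiveSingle, s.IsSPNE := by
  have hbd : ∀ i, ∀ x ∈ Icc (M.r * M.spots i) (M.spots i),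
      0 ≤ x ∧ 0 ≤ M.spots i - x := fun i x hx =>
    capacity_bounds (mem_capacitySet_optimalCapacity.2 hx)
  refine exists_isSPNE_optimalCapacity (fun i _ _ => M.naiveTariff i)
    (fun n i τ => firmProfit_le_naiveTariff n i τ _)
    (F := fun i x y => M.firmProfit i x y (M.naiveTariff i : Tariff)
      (M.naiveTariff (other i) : Tariff))
    (fun _ _ _ _ _ => rfl) ?_ ?_
  · intro i
    have c1 := continuousOn_served M.Wd_pos M.β_pos M.ε_pos (M.preEVPrice i)
      (M.preEVPrice (other i))
      (s := Icc (M.r * M.spots i) (M.spots i) ×ˢ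
        Icc (M.r * M.spots (other i)) (M.spots (other i)))
      (f := fun w => M.spots i - w.1) (g := fun w => M.spots (other i) - w.2) (by fun_prop)
      (by fun_prop) (fun w hw => (hbd _ _ hw.1).2) fun w hw => (hbd _ _ hw.2).2
    have c2 := continuousOn_served M.We_pos M.α_pos M.ε_pos (M.preEVPrice i)
      (M.preEVPrice (other i))
      (s := Icc (M.r * M.spots i) (M.spots i) ×ˢ
        Icc (M.r * M.spots (other i)) (M.spots (other i)))
      (f := fun w => w.1) (g := fun w => w.2) (by fun_prop)
      (by fun_prop) (fun w hw => (hbd _ _ hw.1).1) fun w hw => (hbd _ _ hw.2).1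
    exact ((continuousOn_const.mul c1).add (continuousOn_const.mul c2)).sub (by fun_prop)
  · intro i y hy
    obtain ⟨hy0, hy1⟩ := hbd _ y hy
    have hm : 0 < M.preEVPrice i :=
      eqPrice_pos M.Wd_pos M.β_pos M.ε_pos (M.spots_nonneg i) (M.spots_nonneg _)
    -- The prices are in equilibrium for all spots serving ICE drivers; the opponent now offers only
    -- a part of them.
    have hd : 0 < M.Wd * (1 + M.β * ((M.spots (other i) - y) / M.ε) *
        (M.preEVPrice (other i) - M.preEVPrice i)) - M.preEVPrice i := by
      have := eqPrice_attraction_pos M.Wd_pos M.β_pos M.ε_pos (M.spots_nonneg i) hy1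
        (sub_le_self _ hy0)
      simpa only [preEVPrice, other_other] using this
    simp only [firmProfit, naiveTariff, served_eq_mul_share]
    generalize M.Wd * (1 + M.β * ((M.spots (other i) - y) / M.ε) *
        (M.preEVPrice (other i) - M.preEVPrice i)) - M.preEVPrice i = kd at hd ⊢
    generalize M.We * (1 + M.α * (y / M.ε) *
        (M.preEVPrice (other i) - M.preEVPrice i)) - M.preEVPrice i = ke
    -- For `ke > 0` both revenues are strictly concave. For `ke ≤ 0` concavity of the EV term may
    -- fail, but every EV spot then lowers ICE revenue and does not raise EV revenue, so profit
    -- strictly decreases.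
    rcases lt_or_ge 0 ke with he | he
    · left
      have k1 := strictConcaveOn_const_mul (strictConcaveOn_comp_affine
        (strictConcaveOn_share M.Wd_pos M.β_pos M.ε_pos hy1)
        (convex_Icc (M.r * M.spots i) (M.spots i)) (c := -1) (d := M.spots i) (by norm_num)
        fun x hx => by
          have := (hbd _ _ hx).2
          rw [mem_Ici]; linarith) (mul_pos hm hd)
      have k2 := (strictConcaveOn_const_mul (strictConcaveOn_share M.We_pos M.α_pos M.ε_pos hy0)
        (mul_pos hm he)).subset (fun x hx => (hbd _ _ hx).1)
        (convex_Icc (M.r * M.spots i) (M.spots i))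
      have k3 : ConcaveOn ℝ (Icc (M.r * M.spots i) (M.spots i)) fun x => -(M.p * x) :=
        ⟨convex_Icc _ _, fun x _ y _ a b _ _ _ => le_of_eq (by simp only [smul_eq_mul]; ring)⟩
      refine ((k1.add k2).add_concaveOn k3).congr ?_
      intro x _
      simp only [Pi.add_apply]
      rw [show -1 * x + M.spots i = M.spots i - x by ring]
      ring
    · right
      intro x hx x' hx' hlt
      have h1 := strictMonoOn_share M.Wd_pos M.β_pos M.ε_pos hy1 (hbd _ _ hx').2 (hbd _ _ hx).2
        (sub_lt_sub_left hlt _)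
      have h2 := strictMonoOn_share M.We_pos M.α_pos M.ε_pos hy0 (hbd _ _ hx).1 (hbd _ _ hx').1 hlt
      have h3 := mul_lt_mul_of_pos_left (mul_lt_mul_of_pos_left h1 hd) hm
      have h4 := mul_le_mul_of_nonneg_left (mul_le_mul_of_nonpos_left h2.le he) hm.le
      have h5 := mul_le_mul_of_nonneg_left hlt.le M.p_nonneg
      simp only at h3 h4 ⊢
      linarith

end Market

end EVParking

theorem proposition1 (M : EVParking.Market) :
    (∀ c : EVParking.PricingScheme,
      (∃ s : M.Profile .naiveMandate c, s.IsSPNE) ∧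
      (∀ s s' : M.Profile .naiveMandate c, s.IsSPNE → s'.IsSPNE → s.AgreeOnSpots s') ∧
      (0 < M.δ → M.δ < 1 → (c = .twoPrice → 0 < M.r ∧ M.r < 1) →
        ∃! s : M.Profile .naiveMandate c, s.IsSPNE)) ∧
    (M.α * M.We ≤ 1 → M.β * M.Wd ≤ 1 → M.ε = 1 →
      ∃ s : M.Profile .optimalCapacity .twoPrice, s.IsSPNE) ∧
    (∃ s : M.Profile .optimalCapacity .naiveSingle, s.IsSPNE) := by
  refine ⟨fun c => ⟨EVParking.Market.exists_isSPNE_of_naiveMandate c,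
    fun s s' hs hs' => EVParking.Market.agreeOnSpots_of_isSPNE hs hs', fun h0 h1 hr => ?_⟩,
    fun he hd hε => EVParking.Market.exists_isSPNE_twoPrice_optimalCapacity ?_ ?_,
    EVParking.Market.exists_isSPNE_naiveSingle_optimalCapacity⟩
  · obtain ⟨s, hs⟩ := EVParking.Market.exists_isSPNE_of_naiveMandate (M := M) c
    refine ⟨s, hs, fun s' hs' => (EVParking.Market.agreeOnSpots_of_isSPNE hs' hs).eq ?_ hr⟩
    rw [Fin.forall_fin_two]
    exact ⟨h0, sub_pos.2 h1⟩
  · rwa [hε, div_one]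
  · rwa [hε, div_one]
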